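/- **Setting.** Let $V$ be a finite set of network IDs (nodes), $|V|\le\bar V$, $W$ a set of logical IDs, and $\mathtt{NID}:W\to V$ a map unknown to the agent. An additional node $a$, the agent, has at most $k\ge 2$ peers at a time. Everything below may be random, except for $\mathtt{NID}$ and the link distances. * *Topology.* At time $t\ge 0$ there are a set $V(t)\subseteq V$ of present nodes and an undirected graph $E(t)$ on $V(t)$, both varying arbitrarily. Link distances $w(u,v)$, $u,v\in V\cup\{a\}$, are constant in time, satisfy $0<w(u,v)\le \bar w$ for $u\ne v$, and $w(u,v)\le w(u,z)+w(z,v)$. * *Dissemination.* A message with logical ID $x\in W$ is broadcast by $\mathtt{NID}(x)$. Each node other than $a$ forwards a message, at the moment of its first receipt, to all its neighbours of that moment (the agent included); sent from $u$ to $v$ at time $t$, it arrives at time $t+w(u,v)$. The agent forwards nothing. For every message delivered to it, the agent sees which message it is, the logical ID of its sender, the delivering peer $p$, the time of arrival, and its link distance $w(p,a)$. * *Oracle.* The oracle answers one query of the agent per time $\tau>0$. Conditionally on the past, every node present at the time of the answer is drawn with probability at least $q>0$; the answer is a present node. The agent can send peering requests only to nodes that the oracle has named, and chooses the set of (at most $k$)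 nodes to which it sends requests anew at the times $0,\tau,2\tau,\dots$, from what it has seen before. * *Slots.* Every node has at least $F\ge 1$ dynamic slots. Each slot carries at most one connection at a time; every connection of another node in a dynamic slot is an edge of the network while it lasts, and has an $\mathrm{Exp}(\lambda)$ duration independent of the time at which it is established. Slots are permissionless and served first come, first served, and the agent repeats its requests without pause: if the agent requests a present node $v$ throughout $[s,t]$, it is connected to $v$ at time $t$ unless every dynamic slot of $v$ is occupied by one and the same other connection throughout $[s,t]$. * *Targets and activity.* The targets are given by a finite set $U\subseteq W$ on which $\mathtt{NID}$ is injective, so that $|U|$ is the number of target nodes; these are present at all times. For $x\in U$ the process $M_x(t)$, which counts the messages of $x$ broadcast up to time $t$, is finite for all $t$ and satisfies $$\mathbb P\big[M_x(t+\Delta)-M_x(t)<\gamma\Delta\big]<\frac{\mu}{\Delta}\qquad\text{for all } t,\Delta>0,$$ with constants $\gamma,\mu>0$. A network with these properties is called *quasi-live* (with constants $\bar V,k,F,\lambda,\gamma,\mu,q,\tau,\bar w$). **Theorem.** For all constants $\bar V,k,F,\lambda,\gamma,\mu,q,\tau,\bar w$ as above and every $\epsilon_0\in(0,1)$ there is a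 constant $K>0$ such that for all finite $V$ with $|V|\le\bar V$, all $W$, all finite $U\subseteq W$ and all $\epsilon\in(0,\epsilon_0]$, there are a strategy of the agent and a time $$T\le K\,|U|^2\,\epsilon^{-1}\log^2(\epsilon^{-1})$$ such that in every quasi-live network with these constants and with targets $U$, an agent who follows this strategy knows at time $T$, with probability at least $1-\epsilon$, the network IDs $\mathtt{NID}(x)$ of all $x\in U$. -/

import Mathlib

open MeasureTheory ProbabilityTheory
open scoped ENNReal

namespace PeerNet

/-- The constants of the model. -/
structure Params where
  /-- upper bound on the number of network IDs -/
  maxNodes : ℕ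
  /-- maximal number of simultaneous peers of the agent -/
  maxPeers : ℕ
  /-- every node has (at least) this many dynamic peer slots -/
  slots : ℕ
  /-- rate of the exponential durations of dynamic connections -/
  lam : ℝ
  /-- the two constants of the activity condition -/
  gam : ℝ
  mu : ℝ
  /-- lower bound on the probability with which the oracle draws a given present node -/
  q : ℝ
  /-- time the oracle needs to answer one query -/
  tau : ℝ
  /-- upper bound on the link distances -/
  wmax : ℝ
  two_le_maxPeers : 2 ≤ maxPeers
  slots_pos : 0 < slots
  lam_pos : 0 < lam
  gam_pos : 0 < gam
  mu_pos : 0 < mu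
  q_pos : 0 < q
  tau_pos : 0 < tau
  wmax_pos : 0 < wmax

/-- What the agent records when one of its peers delivers a message to it: the logical ID of the
sender, the identity of the message, the delivering peer, the time of arrival, and the
link distance from that peer to the agent. -/
structure Arrival (V W : Type*) where
  sender : W
  msg : ℕ
  peer : V
  time : ℝ
  link : ℝ

/-- The information available to the agent at some moment: the oracle's answers in order, the
messages delivered to it, and the log of its peer connections. -/
structure View (V W : Type*) where
  answers : List V
  arrivals : Set (Arrival V W)
  peerLog : Set (V × ℝ)

/-- A strategy of the agent with at most `k` peers. From what it has seen it decides
to which nodes it keeps sending peering requests (holding the connection once it has it), and what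
it believes to be the network ID behind each logical ID. It can only address nodes whose
network IDs it was told by the oracle. -/
structure Strategy (V W : Type*) (k : ℕ) where
  request : View V W → Finset V
  output : View V W → W → Option V
  request_known : ∀ I, ∀ v ∈ request I, v ∈ I.answers
  request_card : ∀ I, (request I).card ≤ k

/-- A random evolution of the network together with the agent. `V` is the set of network IDs of
the nodes other than the agent, `W` the set of logical IDs, `C` labels the dynamic connections
between such nodes, `F` is the number of dynamic slots of a node. -/
structure Run (V W C Ω : Type*) (F : ℕ) where
  /-- the network ID behind a logical ID -/
  nid : W → V
  /-- the nodes present at time `t` -/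
  nodes : ℝ → Ω → Set V
  /-- the peer connections between non-agent nodes at time `t` -/
  graph : ℝ → Ω → SimpleGraph V
  /-- link distances; `none` stands for the agent -/
  dist : Option V → Option V → ℝ
  /-- `oracle n` is the answer to the agent's query number `n` -/
  oracle : ℕ → Ω → V
  /-- connection `c` occupies the dynamic slot `slot c` of `host c` and joins it to `guest c` -/
  host : C → V
  slot : C → Fin F
  guest : C → Ω → V
  /-- time at which `c` is established (`⊤`: never) -/
  start : C → Ω → ℝ≥0∞
  dur : C → Ω → ℝ
  /-- time at which message number `n` signed by `w` is broadcast by `nid w` (`⊤`: never) -/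
  sent : W → ℕ → Ω → ℝ≥0∞
  /-- time at which that message first reaches a node (`⊤`: never) -/
  recv : W → ℕ → V → Ω → ℝ≥0∞
  /-- the peers of the agent at time `t` -/
  peers : ℝ → Ω → Set V

namespace Run

variable {V W C Ω : Type*} {F : ℕ}

/-- Connection `c` is up during the whole of `[s, t]`. -/
def Holds (R : Run V W C Ω F) (c : C) (s t : ℝ) (ω : Ω) : Prop :=
  R.start c ω ≤ ENNReal.ofReal s ∧
    ENNReal.ofReal t < R.start c ω + ENNReal.ofReal (R.dur c ω)

/-- The counting process of the messages signed by `w`. -/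
noncomputable def count (R : Run V W C Ω F) (w : W) (t : ℝ) (ω : Ω) : ℕ :=
  {n : ℕ | R.sent w n ω ≤ ENNReal.ofReal t}.ncard

/-- A peer `p` of the agent forwards a message to the agent at the moment at which it
first receives it (provided that they are connected at that moment); it arrives
`dist p agent` later. -/
def Delivers (R : Run V W C Ω F) (ω : Ω) (a : Arrival V W) : Prop :=
  R.recv a.sender a.msg a.peer ω ≠ ⊤ ∧
  a.peer ∈ R.peers (R.recv a.sender a.msg a.peer ω).toReal ω ∧
  a.link = R.dist (some a.peer) none ∧
  a.time = (R.recv a.sender a.msg a.peer ω).toReal + a.link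

/-- What the agent has seen when the clock reaches `n * τ`: the answers to its first `n` queries
(the agent queries the oracle all the time, so that answer number `i` comes at time
`(i + 1) * τ`), and everything that happened at its node before time `n * τ`. -/
def view (R : Run V W C Ω F) (τ : ℝ) (n : ℕ) (ω : Ω) : View V W where
  answers := (List.range n).map fun i => R.oracle i ω
  arrivals := {a | R.Delivers ω a ∧ a.time < n * τ}
  peerLog := {x | 0 ≤ x.2 ∧ x.2 < n * τ ∧ x.1 ∈ R.peers x.2 ω}

/-- The nodes that the agent is requesting at time `t` when it plays `σ`; it reconsiders its
choice whenever the oracle answers. -/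
noncomputable def requested (R : Run V W C Ω F) (τ : ℝ) {k : ℕ} (σ : Strategy V W k)
    (t : ℝ) (ω : Ω) : Finset V :=
  σ.request (R.view τ ⌊t / τ⌋₊ ω)

/-- Message number `n` of `w` is disseminated by flooding: every non-agent node forwards
it, at the moment of its first receipt, to all its neighbours of that moment. The agent does not
forward messages. -/
def Floods (R : Run V W C Ω F) (w : W) (n : ℕ) (ω : Ω) : Prop :=
  R.recv w n (R.nid w) ω = R.sent w n ω ∧
  ∀ v, v ≠ R.nid w →
    R.recv w n v ω =
      ⨅ (u : V) (_ : R.recv w n u ω ≠ ⊤ ∧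
          (R.graph (R.recv w n u ω).toReal ω).Adj u v),
        R.recv w n u ω + ENNReal.ofReal (R.dist (some u) (some v))

/-- The rules of the network that hold along one sample path, when the agent plays `σ` and the
targets are the nodes behind the logical IDs in `U`. -/
structure PathRules (R : Run V W C Ω F) (τ : ℝ) {k : ℕ} (σ : Strategy V W k)
    (U : Finset W) (ω : Ω) : Prop where
  target_mem : ∀ w ∈ U, ∀ t, 0 ≤ t → R.nid w ∈ R.nodes t ω
  adj_mem : ∀ t, 0 ≤ t → ∀ u v, (R.graph t ω).Adj u v → u ∈ R.nodes t ω ∧ v ∈ R.nodes t ω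
  oracle_mem : ∀ n : ℕ, R.oracle n ω ∈ R.nodes ((n + 1) * τ) ω
  /-- a dynamic connection is an edge of the network as long as it lasts -/
  dynamic_adj : ∀ c t, 0 ≤ t → R.Holds c t t ω → (R.graph t ω).Adj (R.host c) (R.guest c ω)
  /-- a dynamic slot carries at most one connection at a time -/
  slot_excl : ∀ c d t, 0 ≤ t → R.host c = R.host d → R.slot c = R.slot d →
    R.Holds c t t ω → R.Holds d t t ω → c = d
  /-- a counting process is finite at every time -/
  sent_finite : ∀ w t, {n : ℕ | R.sent w n ω ≤ ENNReal.ofReal t}.Finite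
  floods : ∀ w n, R.Floods w n ω
  peers_sub : ∀ t, 0 ≤ t → ∀ v ∈ R.peers t ω, v ∈ R.requested τ σ t ω ∧ v ∈ R.nodes t ω
  /-- Slots are permissionless and served first come, first served, and the agent repeats its
  requests without pause. If it has been requesting `v` during all of `[s, t]` and some
  dynamic slot of `v` was not blocked during all of `[s, t]` by one and the same
  connection, then the agent got hold of a slot and (taking it again at once whenever its own
  connection is torn down) still has it at time `t`. -/
  served : ∀ s t, 0 ≤ s → s ≤ t → ∀ v,
    (∀ r, s ≤ r → r ≤ t → v ∈ R.requested τ σ r ω ∧ v ∈ R.nodes r ω) →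
    (∃ i : Fin F, ¬ ∃ c, R.host c = v ∧ R.slot c = i ∧ R.Holds c s t ω) →
    v ∈ R.peers t ω

/-- `R` is a run of a quasi-live network in which the agent plays `σ` and the targets are the nodes
behind the logical IDs in `U`. -/
structure IsQuasiLive [MeasurableSpace Ω] (prm : Params) (R : Run V W C Ω prm.slots)
    (σ : Strategy V W prm.maxPeers) (U : Finset W) (P : Measure Ω) : Prop where
  nid_inj : Set.InjOn R.nid U
  dist_pos : ∀ u v, u ≠ v → 0 < R.dist u v
  dist_le : ∀ u v, u ≠ v → R.dist u v ≤ prm.wmax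
  triangle : ∀ u v z, R.dist u v ≤ R.dist u z + R.dist z v
  rules : ∀ᵐ ω ∂P, R.PathRules prm.tau σ U ω
  /-- Given the history `H n` up to query number `n` (which comprises the earlier answers and the
  set of present nodes), each present node is drawn with probability at least `q`. -/
  oracle_draw : ∃ H : ℕ → MeasurableSpace Ω,
    (∀ n, H n ≤ ‹MeasurableSpace Ω›) ∧
    (∀ n m v, m < n → MeasurableSet[H n] {ω | R.oracle m ω = v}) ∧
    (∀ n v, MeasurableSet {ω | R.oracle n ω = v}) ∧
    (∀ (n : ℕ) v, MeasurableSet[H n] {ω | v ∈ R.nodes ((n + 1) * prm.tau) ω}) ∧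
    ∀ (n : ℕ) v A, MeasurableSet[H n] A →
      ENNReal.ofReal prm.q * P (A ∩ {ω | v ∈ R.nodes ((n + 1) * prm.tau) ω}) ≤
        P (A ∩ {ω | R.oracle n ω = v})
  /-- dynamic connections last for an `Exp(lam)` time, whenever they were established -/
  start_meas : ∀ c, Measurable (R.start c)
  dur_meas : ∀ c, Measurable (R.dur c)
  dur_law : ∀ c, P.map (R.dur c) = expMeasure prm.lam
  dur_indep : ∀ c, IndepFun (R.start c) (R.dur c) P
  sent_meas : ∀ w n, Measurable (R.sent w n)
  /-- the activity condition on the targets -/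
  active : ∀ w ∈ U, ∀ t Δ : ℝ, 0 < t → 0 < Δ →
    P {ω | (R.count w (t + Δ) ω : ℝ) - R.count w t ω < prm.gam * Δ} <
      ENNReal.ofReal (prm.mu / Δ)

/-- At step `n` the agent names the correct network ID for every target. -/
def Found (R : Run V W C Ω F) (τ : ℝ) {k : ℕ} (σ : Strategy V W k) (U : Finset W)
    (n : ℕ) (ω : Ω) : Prop :=
  ∀ w ∈ U, σ.output (R.view τ n ω) w = some (R.nid w)

end Run

end PeerNet

namespace PeerNet

namespace Run

variable {V W C Ω : Type*} {F : ℕ}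

/-! ### Flooding -/

/-! A message of `x` reaches `R.nid x` at the moment of broadcast and every other node strictly
later, because link distances are positive. Subtracting the link distance from an arrival time
recovers the peer's first receipt, so comparing the receipts of two peers exposes the target,
however the topology behaves.

The agent queries the oracle for `N` steps and then gives each ordered pair of nodes a block of `B`
steps, in which it requests both. A block has a connection phase `L`, a margin `D` exceeding any
flooding time, and a window of length `Δ` whose receipts are compared. The margin protects the
target: whatever a rival receives in the window was broadcast when the target was already connected.
A message broadcast in the window defeats any rival paired with the target. Hence, on the good
event, the target is the only unbeaten node (`PathRules.found_roundRobin`).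

The good event fails if a target is not named (at most `exp (-q N)` for each target), if a slot
stays blocked (`exp (-lam L)` for each node and block, by lack of memory), or if a target is silent
in a window (`mu / Δ`). By the union bound, `N`, `L` and `Δ` of order `U.card / ε` suffice. The
total time is then also of order `U.card / ε`; the remaining factors of the stated bound are slack,
as `log ε⁻¹` is bounded away from 0 for `ε ≤ ε₀`. -/

theorem Floods.exists_forwarder [Finite V] {R : Run V W C Ω F} {w : W} {n : ℕ} {ω : Ω}
    (h : R.Floods w n ω) {v : V} (hv : v ≠ R.nid w) (hfin : R.recv w n v ω ≠ ⊤) :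
    ∃ u, u ≠ v ∧ R.recv w n u ω ≠ ⊤ ∧
      R.recv w n v ω = R.recv w n u ω + ENNReal.ofReal (R.dist (some u) (some v)) := by
  have key := h.2 v hv
  rw [iInf_subtype'] at key
  cases isEmpty_or_nonempty {u : V // R.recv w n u ω ≠ ⊤ ∧
      (R.graph (R.recv w n u ω).toReal ω).Adj u v} with
  | inl _ => rw [iInf_of_empty] at key; exact absurd key hfin
  | inr _ =>
    obtain ⟨⟨u, hu, hadj⟩, hmin⟩ := exists_eq_ciInf_of_finite
      (f := fun u : {u : V // R.recv w n u ω ≠ ⊤ ∧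
        (R.graph (R.recv w n u ω).toReal ω).Adj u v} =>
          R.recv w n u ω + ENNReal.ofReal (R.dist (some (u : V)) (some v)))
    exact ⟨u, hadj.ne, hu, key.trans hmin.symm⟩

/-- Tracing a receipt back to its forwarder leads to a strictly earlier receipt and costs at most
`d`. Induction on the number of strictly earlier receivers makes this descent end at the sender. -/
theorem Floods.recv_bounds [Fintype V] {R : Run V W C Ω F} {w : W} {n : ℕ} {ω : Ω} {d : ℝ}
    (h : R.Floods w n ω) (hpos : ∀ u v, u ≠ v → 0 < R.dist u v)
    (hle : ∀ u v, u ≠ v → R.dist u v ≤ d) {v : V} (hfin : R.recv w n v ω ≠ ⊤) :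
    R.sent w n ω ≤ R.recv w n v ω ∧ (v ≠ R.nid w → R.sent w n ω < R.recv w n v ω) ∧
      R.recv w n v ω ≤
        R.sent w n ω + {u | R.recv w n u ω < R.recv w n v ω}.ncard * ENNReal.ofReal d := by
  induction hk : {u | R.recv w n u ω < R.recv w n v ω}.ncard using Nat.strong_induction_on
    generalizing v with
  | _ k ih =>
    by_cases hv : v = R.nid w
    · subst hv
      rw [h.1]
      exact ⟨le_rfl, fun h => absurd rfl h, le_self_add⟩
    · obtain ⟨u, huv, hu, heq⟩ := h.exists_forwarder hv hfin
      have hd : 0 < ENNReal.ofReal (R.dist (some u) (some v)) :=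
        ENNReal.ofReal_pos.2 (hpos _ _ (by simpa using huv))
      have hlt : R.recv w n u ω < R.recv w n v ω := by
        rw [heq]; exact ENNReal.lt_add_right hu hd.ne'
      have hcard : {x | R.recv w n x ω < R.recv w n u ω}.ncard < k := by
        rw [← hk]
        refine Set.ncard_lt_ncard ⟨fun x hx => lt_trans hx hlt, fun hsub => ?_⟩ (Set.toFinite _)
        exact lt_irrefl (R.recv w n u ω) (hsub (show u ∈ {x | _} from hlt))
      obtain ⟨h1, -, h3⟩ := ih _ hcard hu rfl
      refine ⟨h1.trans hlt.le, fun _ => h1.trans_lt hlt, ?_⟩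
      calc R.recv w n v ω
          ≤ (R.sent w n ω + {x | R.recv w n x ω < R.recv w n u ω}.ncard * ENNReal.ofReal d)
              + ENNReal.ofReal d := by
            rw [heq]
            exact add_le_add h3 (ENNReal.ofReal_le_ofReal (hle _ _ (by simpa using huv)))
        _ = R.sent w n ω + (({x | R.recv w n x ω < R.recv w n u ω}.ncard + 1 : ℕ) : ℝ≥0∞)
              * ENNReal.ofReal d := by push_cast; ring
        _ ≤ _ := by gcongr; exact hcard

theorem Floods.recv_toReal_bounds [Fintype V] {R : Run V W C Ω F} {w : W} {n : ℕ} {ω : Ω} {d : ℝ}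
    (h : R.Floods w n ω) (hpos : ∀ u v, u ≠ v → 0 < R.dist u v)
    (hle : ∀ u v, u ≠ v → R.dist u v ≤ d) (hd : 0 ≤ d) {v : V} (hv : v ≠ R.nid w)
    (hfin : R.recv w n v ω ≠ ⊤) :
    R.sent w n ω ≠ ⊤ ∧ (R.sent w n ω).toReal < (R.recv w n v ω).toReal ∧
      (R.recv w n v ω).toReal ≤ (R.sent w n ω).toReal + Fintype.card V * d := by
  obtain ⟨h1, h2, h3⟩ := h.recv_bounds hpos hle hfin
  have hs : R.sent w n ω ≠ ⊤ := ne_top_of_le_ne_top hfin h1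
  refine ⟨hs, (ENNReal.toReal_lt_toReal hs hfin).2 (h2 hv), ?_⟩
  have h4 : R.recv w n v ω ≤ R.sent w n ω + ENNReal.ofReal (Fintype.card V * d) := by
    rw [ENNReal.ofReal_mul (by positivity), ENNReal.ofReal_natCast]
    refine h3.trans ?_
    gcongr
    rw [← Nat.card_eq_fintype_card]
    exact Set.ncard_le_card _
  have h5 := ENNReal.toReal_mono (ENNReal.add_ne_top.2 ⟨hs, ENNReal.ofReal_ne_top⟩) h4
  rwa [ENNReal.toReal_add hs ENNReal.ofReal_ne_top, ENNReal.toReal_ofReal (by positivity)] at h5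

theorem exists_sent_of_count_lt {R : Run V W C Ω F} {w : W} {s t : ℝ} {ω : Ω}
    (hfin : {n : ℕ | R.sent w n ω ≤ ENNReal.ofReal s}.Finite) (hs : 0 ≤ s) (ht : 0 ≤ t)
    (h : R.count w s ω < R.count w t ω) :
    ∃ n, R.sent w n ω ≠ ⊤ ∧ s < (R.sent w n ω).toReal ∧ (R.sent w n ω).toReal ≤ t := by
  by_contra! hno
  -- Without a broadcast in `(s, t]` the set counted at `t` lies in the one counted at `s`.
  -- Finiteness is needed since `ncard` of an infinite set is 0.
  refine absurd h (not_lt.2 (Set.ncard_le_ncard (fun n hn => ?_) hfin))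
  by_contra hlt
  have hlt : ENNReal.ofReal s < R.sent w n ω := not_le.1 hlt
  have hn : R.sent w n ω ≤ ENNReal.ofReal t := hn
  have htop : R.sent w n ω ≠ ⊤ := ne_top_of_le_ne_top ENNReal.ofReal_ne_top hn
  have h1 : s < (R.sent w n ω).toReal := (ENNReal.ofReal_lt_iff_lt_toReal hs htop).1 hlt
  have h2 := ENNReal.toReal_mono ENNReal.ofReal_ne_top hn
  rw [ENNReal.toReal_ofReal ht] at h2
  exact absurd h2 (not_le.2 (hno n htop h1))

theorem Holds.mono {R : Run V W C Ω F} {c : C} {s t t' : ℝ} {ω : Ω} (h : R.Holds c s t ω)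
    (ht : t' ≤ t) : R.Holds c s t' ω :=
  ⟨h.1, (ENNReal.ofReal_le_ofReal ht).trans_lt h.2⟩

end Run

/-! ### The round-robin strategy -/

section RoundRobin

variable {V W : Type*} [Fintype V]

/-- The first step of the block of `B` steps reserved for the pair `p`, when `N` steps are spent
on the oracle alone. -/
noncomputable def blockStart (N B : ℕ) (p : V × V) : ℕ :=
  N + (Fintype.equivFin (V × V) p : ℕ) * B

theorem blockStart_add_le (N B : ℕ) (p : V × V) :
    blockStart N B p + B ≤ N + Fintype.card V ^ 2 * B := by
  have h : (Fintype.equivFin (V × V) p : ℕ) + 1 ≤ Fintype.card V ^ 2 := by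
    rw [sq, ← Fintype.card_prod]
    exact (Fintype.equivFin (V × V) p).isLt
  unfold blockStart
  nlinarith [Nat.mul_le_mul_right B h]

theorem blockStart_injective_of_mem {N B n : ℕ} {p p' : V × V}
    (hp : blockStart N B p ≤ n) (hp' : n < blockStart N B p + B)
    (hq : blockStart N B p' ≤ n) (hq' : n < blockStart N B p' + B) : p = p' := by
  unfold blockStart at *
  apply (Fintype.equivFin (V × V)).injective
  apply Fin.ext
  by_contra hne
  rcases Nat.lt_or_gt_of_ne hne with h | h <;> nlinarith [Nat.mul_le_mul_right B (Nat.succ_le_of_lt h)]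

open Classical in
/-- The known nodes among the two to which the block comprising the present step is reserved. -/
noncomputable def roundRobinRequest (N B : ℕ) (I : View V W) : Finset V :=
  Finset.univ.filter fun v => v ∈ I.answers ∧ ∃ p : V × V, (v = p.1 ∨ v = p.2) ∧
    blockStart N B p ≤ I.answers.length ∧ I.answers.length < blockStart N B p + B

theorem roundRobinRequest_card (N B : ℕ) (I : View V W) :
    (roundRobinRequest N B I).card ≤ 2 := by
  classical
  by_cases h : ∃ p : V × V,
    blockStart N B p ≤ I.answers.length ∧ I.answers.length < blockStart N B p + B
  · obtain ⟨p, h1, h2⟩ := h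
    refine (Finset.card_le_card (t := {p.1, p.2}) fun v hv => ?_).trans Finset.card_le_two
    obtain ⟨-, p', hv, h3, h4⟩ := (Finset.mem_filter.1 hv).2
    obtain rfl := blockStart_injective_of_mem h1 h2 h3 h4
    simpa using hv
  · have : roundRobinRequest N B I = ∅ := by
      refine Finset.filter_false_of_mem fun v _ hv => h ?_
      obtain ⟨-, p, -, h1⟩ := hv
      exact ⟨p, h1⟩
    simp [this]

/-- No other known node `p` has received a message of `x`, in the part `[lo, hi]` of the block of
`(u, p)`, that `u` had not received before. -/
def Unbeaten (τ : ℝ) (N B : ℕ) (lo hi : ℝ) (I : View V W) (x : W) (u : V) : Prop :=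
  u ∈ I.answers.take N ∧ ∀ a ∈ I.arrivals, a.sender = x → a.peer ≠ u →
    a.peer ∈ I.answers.take N →
    blockStart N B (u, a.peer) * τ + lo ≤ a.time - a.link →
    a.time - a.link ≤ blockStart N B (u, a.peer) * τ + hi →
    ∃ b ∈ I.arrivals, b.sender = x ∧ b.msg = a.msg ∧ b.peer = u ∧
      b.time - b.link < a.time - a.link

open Classical in
/-- Compare all pairs of known nodes in turn, and name a node that has never been beaten. -/
noncomputable def roundRobin (k : ℕ) (hk : 2 ≤ k) (τ : ℝ) (N B : ℕ) (lo hi : ℝ) :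
    Strategy V W k where
  request := roundRobinRequest N B
  output I x := if h : ∃ u, Unbeaten τ N B lo hi I x u then some h.choose else none
  request_known _ _ hv := (Finset.mem_filter.1 hv).2.1
  request_card I := (roundRobinRequest_card N B I).trans hk

end RoundRobin

/-! ### Correctness of the comparison along one sample path -/

namespace Run

variable {V W C Ω : Type*} {F : ℕ}

theorem mem_view_answers {R : Run V W C Ω F} {τ : ℝ} {n : ℕ} {ω : Ω} {v : V} :
    v ∈ (R.view τ n ω).answers ↔ ∃ i < n, R.oracle i ω = v := by
  simp [view]

theorem mem_view_answers_take {R : Run V W C Ω F} {τ : ℝ} {N n : ℕ} (hN : N ≤ n) {ω : Ω} {v : V} :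
    v ∈ (R.view τ n ω).answers.take N ↔ ∃ i < N, R.oracle i ω = v := by
  simp [view, ← List.map_take, List.take_range, hN]

/-- Slot `i` of `v` is blocked by one connection during `[s, t]`. -/
def Blocked (R : Run V W C Ω F) (v : V) (i : Fin F) (s t : ℝ) (ω : Ω) : Prop :=
  ∃ c, R.host c = v ∧ R.slot c = i ∧ R.Holds c s t ω

variable [Fintype V] {R : Run V W C Ω F} {τ : ℝ} {k : ℕ} {hk : 2 ≤ k} {N B : ℕ} {lo hi : ℝ}
  {U : Finset W} {ω : Ω}

theorem mem_requested_roundRobin (hτ : 0 < τ) {v : V} (hv : ∃ i < N, R.oracle i ω = v) {p : V × V}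
    (hp : v = p.1 ∨ v = p.2) {r : ℝ} (h1 : blockStart N B p * τ ≤ r)
    (h2 : r < (blockStart N B p + B : ℕ) * τ) :
    v ∈ R.requested τ (roundRobin k hk τ N B lo hi) r ω := by
  have hr : 0 ≤ r / τ := div_nonneg (le_trans (by positivity) h1) hτ.le
  have h3 : blockStart N B p ≤ ⌊r / τ⌋₊ := Nat.le_floor ((le_div_iff₀ hτ).2 h1)
  have h4 : ⌊r / τ⌋₊ < blockStart N B p + B := (Nat.floor_lt hr).2 ((div_lt_iff₀ hτ).2 h2)
  classical
  refine Finset.mem_filter.2 ⟨Finset.mem_univ _, ?_, p, hp, ?_⟩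
  · obtain ⟨i, hi, rfl⟩ := hv
    exact mem_view_answers.2 ⟨i, hi.trans_le (le_trans (Nat.le_add_right _ _) h3), rfl⟩
  · simpa [view] using And.intro h3 h4

/-- The target is requested from the start of the block on. A slot that no single connection holds
for the first `L` time units is not held by a single connection over any longer stretch either, so
service is guaranteed at every later time of the block. -/
theorem PathRules.mem_peers_roundRobin
    (h : R.PathRules τ (roundRobin k hk τ N B lo hi) U ω) (hτ : 0 < τ) {x : W} (hx : x ∈ U)
    (hv : ∃ i < N, R.oracle i ω = R.nid x) {p : V × V} (hp : R.nid x = p.1 ∨ R.nid x = p.2)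
    {i : Fin F} {L : ℝ} (hL : 0 ≤ L)
    (hfree : ¬ R.Blocked (R.nid x) i (blockStart N B p * τ) (blockStart N B p * τ + L) ω)
    {t : ℝ} (h1 : blockStart N B p * τ + L ≤ t) (h2 : t < (blockStart N B p + B : ℕ) * τ) :
    R.nid x ∈ R.peers t ω := by
  have hs : 0 ≤ (blockStart N B p : ℝ) * τ := by positivity
  refine h.served (blockStart N B p * τ) t hs (by linarith) _ (fun r hr hrt => ⟨?_, ?_⟩) ⟨i, ?_⟩
  · exact mem_requested_roundRobin hτ hv hp hr (hrt.trans_lt h2)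
  · exact h.target_mem x hx r (hs.trans hr)
  · rintro ⟨c, hc, hc', hold⟩
    exact hfree ⟨c, hc, hc', hold.mono h1⟩

/-- If all targets are named in time, get connected in time in all of their blocks and send a
message in the relevant part of each of these, then the strategy succeeds. -/
theorem PathRules.found_roundRobin {d L D Δ : ℝ} {M : ℕ}
    (h : R.PathRules τ (roundRobin k hk τ N B (L + D) (L + D + Δ)) U ω) (hτ : 0 < τ)
    (hpos : ∀ u v, u ≠ v → 0 < R.dist u v) (hle : ∀ u v, u ≠ v → R.dist u v ≤ d) (hd : 0 ≤ d)
    (hD : Fintype.card V * d ≤ D) (hL : 0 ≤ L) (hΔ : 0 ≤ Δ) (hB : L + D + Δ < B * τ)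
    (hM : (N + Fintype.card V ^ 2 * B : ℕ) * τ + d ≤ M * τ) (i : Fin F)
    (hnamed : ∀ x ∈ U, ∃ i < N, R.oracle i ω = R.nid x)
    (hfree : ∀ (p : V × V) v,
      ¬ R.Blocked v i (blockStart N B p * τ) (blockStart N B p * τ + L) ω)
    (hact : ∀ x ∈ U, ∀ p : V × V, R.count x (blockStart N B p * τ + (L + D)) ω <
      R.count x (blockStart N B p * τ + (L + D) + Δ) ω) :
    R.Found τ (roundRobin k hk τ N B (L + D) (L + D + Δ)) U M ω := by
  classical
  intro x hx
  have hD0 : 0 ≤ D := le_trans (by positivity) hD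
  -- The time `d` reserved after the last block lets every receipt in a window arrive before the
  -- final view is taken.
  have hend (p : V × V) : (blockStart N B p : ℝ) * τ + (L + D + Δ) + d < M * τ := by
    have h1 : ((blockStart N B p + B : ℕ) : ℝ) * τ ≤ (N + Fintype.card V ^ 2 * B : ℕ) * τ :=
      mul_le_mul_of_nonneg_right (by exact_mod_cast blockStart_add_le N B p) hτ.le
    push_cast at h1 hM
    nlinarith
  have hNM : N ≤ M := by
    have h1 : ((N + Fintype.card V ^ 2 * B : ℕ) : ℝ) ≤ M :=
      le_of_mul_le_mul_right (by linarith) hτ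
    have h2 : N + Fintype.card V ^ 2 * B ≤ M := by exact_mod_cast h1
    exact (Nat.le_add_right _ _).trans h2
  have hdist (v : V) : R.dist (some v) none ≤ d := hle _ _ (by simp)
  -- the direct delivery of a message by the target
  have hdirect (p : V × V) (hp : R.nid x = p.1 ∨ R.nid x = p.2) (n : ℕ)
      (hn : R.sent x n ω ≠ ⊤) (h1 : blockStart N B p * τ + L ≤ (R.sent x n ω).toReal)
      (h2 : (R.sent x n ω).toReal ≤ blockStart N B p * τ + (L + D + Δ)) :
      (⟨x, n, R.nid x, (R.sent x n ω).toReal + R.dist (some (R.nid x)) none,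
        R.dist (some (R.nid x)) none⟩ : Arrival V W) ∈ (R.view τ M ω).arrivals := by
    have hrec : R.recv x n (R.nid x) ω = R.sent x n ω := (h.floods x n).1
    refine ⟨⟨?_, ?_, rfl, ?_⟩, ?_⟩
    · simpa [hrec] using hn
    · simp only [hrec]
      refine h.mem_peers_roundRobin hτ hx (hnamed x hx) hp hL (hfree p _) h1 ?_
      push_cast
      linarith
    · simp [hrec]
    · have := hend p
      have := hdist (R.nid x)
      show (R.sent x n ω).toReal + R.dist (some (R.nid x)) none < M * τ
      linarith
  -- A rival's receipt in the window belongs to a message broadcast at most `D` earlier, hence at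
  -- least `L` into the block. The target is connected by then and reports the same message with a
  -- strictly earlier receipt.
  have hgood : Unbeaten τ N B (L + D) (L + D + Δ) (R.view τ M ω) x (R.nid x) := by
    refine ⟨(mem_view_answers_take hNM).2 (hnamed x hx), ?_⟩
    rintro ⟨y, n, v, t, l⟩ ⟨⟨hfin, -, hl, ht⟩, -⟩ hy hv - h1 h2
    dsimp only at *
    subst hy
    rw [ht, add_sub_cancel_right] at h1 h2 ⊢
    obtain ⟨hs, hlt, hbd⟩ := (h.floods y n).recv_toReal_bounds hpos hle hd hv hfin
    exact ⟨_, hdirect (R.nid y, v) (Or.inl rfl) n hs (by linarith) (by linarith), rfl, rfl, rfl,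
      by simpa using hlt⟩
  -- In the block of `(u, R.nid x)` the target reports a message that it broadcasts in the window;
  -- an answer by `u` would require a receipt before the broadcast.
  have huniq : ∀ u, Unbeaten τ N B (L + D) (L + D + Δ) (R.view τ M ω) x u → u = R.nid x := by
    rintro u ⟨-, hu⟩
    by_contra hne
    have hs : 0 ≤ (blockStart N B (u, R.nid x) : ℝ) * τ := by positivity
    obtain ⟨n, hn, h1, h2⟩ := exists_sent_of_count_lt (h.sent_finite x _) (by linarith)
      (by linarith) (hact x hx (u, R.nid x))
    obtain ⟨⟨y, m, v, t, l⟩, ⟨⟨hfin, -, hl, ht⟩, -⟩, hy, hm, hv, hlt⟩ :=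
      hu _ (hdirect (u, R.nid x) (Or.inr rfl) n hn (by linarith) (by linarith)) rfl (Ne.symm hne)
        ((mem_view_answers_take hNM).2 (hnamed x hx)) (by simpa using h1.le)
        (by simp only [add_sub_cancel_right]; linarith)
    dsimp only at *
    subst hy hm hv
    rw [ht, add_sub_cancel_right, add_sub_cancel_right] at hlt
    have := ((h.floods y m).recv_toReal_bounds hpos hle hd hne hfin).2.1
    linarith
  have hex : ∃ u, Unbeaten τ N B (L + D) (L + D + Δ) (R.view τ M ω) x u := ⟨_, hgood⟩
  show (if h : ∃ u, Unbeaten τ N B (L + D) (L + D + Δ) (R.view τ M ω) x u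
    then some h.choose else none) = _
  rw [dif_pos hex, huniq _ hex.choose_spec]

end Run

end PeerNet

namespace PeerNet

/-! ### Probability estimates -/

theorem expMeasure_Ioi {r : ℝ} (hr : 0 < r) {x : ℝ} (hx : 0 ≤ x) :
    expMeasure r (Set.Ioi x) = ENNReal.ofReal (Real.exp (-(r * x))) := by
  have := isProbabilityMeasure_expMeasure hr
  have h := cdf_expMeasure_eq hr x
  rw [cdf_eq_real, if_pos hx] at h
  rw [← ofReal_measureReal, ← Set.compl_Iic, probReal_compl_eq_one_sub measurableSet_Iic, h]
  congr 1
  ring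

section Exp

variable {Ω : Type*} [MeasurableSpace Ω] {P : Measure Ω} [IsProbabilityMeasure P]

/-- An `Exp(lam)` lifetime that starts at an independent random time and covers `s` covers
`[s, s + L]` with conditional probability `exp (-lam * L)`. -/
theorem measure_lifetime_covers {X : Ω → ℝ≥0∞} {Y : Ω → ℝ} (hX : Measurable X)
    (hY : Measurable Y) {lam : ℝ} (hlam : 0 < lam) (hlaw : P.map Y = expMeasure lam)
    (hind : IndepFun X Y P) {s L : ℝ} (hs : 0 ≤ s) (hL : 0 ≤ L) :
    P {ω | X ω ≤ ENNReal.ofReal s ∧ ENNReal.ofReal (s + L) < X ω + ENNReal.ofReal (Y ω)} =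
      ENNReal.ofReal (Real.exp (-(lam * L))) *
        P {ω | X ω ≤ ENNReal.ofReal s ∧ ENNReal.ofReal s < X ω + ENNReal.ofReal (Y ω)} := by
  have := isProbabilityMeasure_expMeasure hlam
  let S (t : ℝ) : Set (ℝ≥0∞ × ℝ) :=
    {z | z.1 ≤ ENNReal.ofReal s ∧ ENNReal.ofReal t < z.1 + ENNReal.ofReal z.2}
  have hS (t : ℝ) : MeasurableSet (S t) :=
    (measurableSet_le measurable_fst measurable_const).inter
      (measurableSet_lt measurable_const
        (measurable_fst.add (ENNReal.measurable_ofReal.comp measurable_snd)))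
  have hP (t : ℝ) : P {ω | X ω ≤ ENNReal.ofReal s ∧
      ENNReal.ofReal t < X ω + ENNReal.ofReal (Y ω)} =
      ∫⁻ a, expMeasure lam (Prod.mk a ⁻¹' S t) ∂(P.map X) := by
    have hmap := (indepFun_iff_map_prod_eq_prod_map_map hX.aemeasurable hY.aemeasurable).1 hind
    rw [hlaw] at hmap
    rw [← Measure.prod_apply (hS t), ← hmap, Measure.map_apply (hX.prodMk hY) (hS t)]
    rfl
  -- Given `X = a ≤ s`, covering up to `t` means `Y > t - a`. The tails at `t = s + L` and `t = s`
  -- differ by the factor `exp (-lam * L)`, whatever `a` is.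
  have hsec {a : ℝ≥0∞} (ha : a ≤ ENNReal.ofReal s) {t : ℝ} (ht : s ≤ t) :
      expMeasure lam (Prod.mk a ⁻¹' S t) =
        ENNReal.ofReal (Real.exp (-(lam * (t - a.toReal)))) := by
    have htop : a ≠ ⊤ := ne_top_of_le_ne_top ENNReal.ofReal_ne_top ha
    have ha' : a.toReal ≤ s := ENNReal.toReal_le_of_le_ofReal hs ha
    rw [← expMeasure_Ioi hlam (by linarith)]
    congr 1
    ext y
    have h0 : a = ENNReal.ofReal a.toReal := (ENNReal.ofReal_toReal htop).symm
    simp only [S, Set.mem_preimage, Set.mem_ofPred_eq, ha, true_and, Set.mem_Ioi]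
    rcases le_total 0 y with hy | hy
    · rw [h0, ← ENNReal.ofReal_add ENNReal.toReal_nonneg hy,
        ENNReal.ofReal_lt_ofReal_iff_of_nonneg (hs.trans ht), ← h0]
      constructor <;> intro h <;> linarith
    -- Negative durations are truncated to 0 and cover nothing, as `a ≤ s ≤ t`.
    · rw [ENNReal.ofReal_of_nonpos hy, add_zero]
      refine ⟨fun h => absurd (h.trans_le ha) ?_, fun h => by linarith⟩
      exact not_lt.2 (ENNReal.ofReal_le_ofReal ht)
  rw [hP, hP, ← lintegral_const_mul' _ _ ENNReal.ofReal_ne_top]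
  refine lintegral_congr fun a => ?_
  by_cases ha : a ≤ ENNReal.ofReal s
  · rw [hsec ha (by linarith), hsec ha le_rfl, ← ENNReal.ofReal_mul (Real.exp_nonneg _),
      ← Real.exp_add]
    congr 2
    ring
  · have (t : ℝ) : Prod.mk a ⁻¹' S t = ∅ := by
      ext y
      simp [S, ha]
    simp [this]

end Exp

/-! ### Failure probabilities in a quasi-live network -/

namespace Run.IsQuasiLive

variable {V W C Ω : Type*} [MeasurableSpace Ω] {prm : Params}
  {R : Run V W C Ω prm.slots} {σ : Strategy V W prm.maxPeers} {U : Finset W} {P : Measure Ω}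
  [IsProbabilityMeasure P]

/-- A blocking connection is already up at `s` and must survive for another `L`, which costs the
factor `exp (-lam * L)`. The number of candidate connections does not matter: the events of being up
at `s` in one slot are almost surely disjoint, so their probabilities sum to at most 1. -/
theorem measure_blocked_le [Countable C] (h : R.IsQuasiLive prm σ U P) (v : V) (i : Fin prm.slots)
    {s L : ℝ} (hs : 0 ≤ s) (hL : 0 ≤ L) :
    P {ω | R.Blocked v i s (s + L) ω} ≤ ENNReal.ofReal (Real.exp (-(prm.lam * L))) := by
  let D := {c : C // R.host c = v ∧ R.slot c = i}
  have hmeas (c : D) : MeasurableSet {ω | R.Holds c s s ω} :=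
    (measurableSet_le (h.start_meas c) measurable_const).inter
      (measurableSet_lt measurable_const
        ((h.start_meas c).add (ENNReal.measurable_ofReal.comp (h.dur_meas c))))
  have hdisj : Pairwise (Function.onFun (AEDisjoint P) fun c : D => {ω | R.Holds c s s ω}) := by
    intro c d hcd
    refine measure_mono_null (fun ω hω => ?_) (ae_iff.1 h.rules)
    intro hr
    refine hcd (Subtype.ext (hr.slot_excl c d s hs ?_ ?_ hω.1 hω.2))
    · rw [c.2.1, d.2.1]
    · rw [c.2.2, d.2.2]
  calc P {ω | R.Blocked v i s (s + L) ω}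
      ≤ P (⋃ c : D, {ω | R.Holds c s (s + L) ω}) := by
        refine measure_mono fun ω => ?_
        rintro ⟨c, h1, h2, h3⟩
        exact Set.mem_iUnion.2 ⟨⟨c, h1, h2⟩, h3⟩
    _ ≤ ∑' c : D, P {ω | R.Holds c s (s + L) ω} := measure_iUnion_le _
    _ = ∑' c : D, ENNReal.ofReal (Real.exp (-(prm.lam * L))) * P {ω | R.Holds c s s ω} :=
        tsum_congr fun c => measure_lifetime_covers (h.start_meas c) (h.dur_meas c) prm.lam_pos
          (h.dur_law c) (h.dur_indep c) hs hL
    _ = ENNReal.ofReal (Real.exp (-(prm.lam * L))) * P (⋃ c : D, {ω | R.Holds c s s ω}) := by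
        rw [ENNReal.tsum_mul_left,
          measure_iUnion₀ hdisj fun c => (hmeas c).nullMeasurableSet]
    _ ≤ _ := mul_le_of_le_one_right' prob_le_one

/-- The target is always present, so each query misses it with conditional probability at most `1 -
q ≤ exp (-q)` given the earlier misses. -/
theorem measure_not_named_le (h : R.IsQuasiLive prm σ U P) {x : W} (hx : x ∈ U) (n : ℕ) :
    P {ω | ∀ i < n, R.oracle i ω ≠ R.nid x} ≤ ENNReal.ofReal (Real.exp (-(prm.q * n))) := by
  obtain ⟨H, hH, hpast, hmeas, -, hdraw⟩ := h.oracle_draw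
  induction n with
  | zero => simp
  | succ n ih =>
    set A : Set Ω := {ω | ∀ i < n, R.oracle i ω ≠ R.nid x} with hA
    have hAm : MeasurableSet[H n] A := by
      have : A = ⋂ i ∈ Finset.range n, {ω | R.oracle i ω = R.nid x}ᶜ := by
        ext ω; simp [hA]
      rw [this]
      refine Finset.measurableSet_biInter _ fun i hi => ?_
      exact (hpast n i _ (Finset.mem_range.1 hi)).compl
    have hstep := hdraw n (R.nid x) A hAm
    have hpres : P (A ∩ {ω | R.nid x ∈ R.nodes ((n + 1) * prm.tau) ω}) = P A := by
      refine measure_congr ?_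
      filter_upwards [h.rules] with ω hω
      have := hω.target_mem x hx ((n + 1) * prm.tau)
        (mul_nonneg (by positivity) prm.tau_pos.le)
      exact propext ⟨fun h => h.1, fun h => ⟨h, this⟩⟩
    rw [hpres] at hstep
    have hdiff : A \ {ω | R.oracle n ω = R.nid x} =
        {ω | ∀ i < n + 1, R.oracle i ω ≠ R.nid x} := by
      ext ω
      simp only [hA, Set.mem_sdiff, Set.mem_ofPred_eq, Order.lt_add_one_iff]
      constructor
      · rintro ⟨h1, h2⟩ i hi
        rcases hi.lt_or_eq with hi | rfl
        exacts [h1 i hi, h2]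
      · exact fun h => ⟨fun i hi => h i hi.le, h n le_rfl⟩
    rw [← hdiff]
    have hreal : P.real (A ∩ {ω | R.oracle n ω = R.nid x}) +
        P.real (A \ {ω | R.oracle n ω = R.nid x}) = P.real A :=
      measureReal_inter_add_sdiff (hmeas n (R.nid x))
    have hstep' : prm.q * P.real A ≤ P.real (A ∩ {ω | R.oracle n ω = R.nid x}) := by
      have := ENNReal.toReal_mono (measure_ne_top P _) hstep
      rwa [ENNReal.toReal_mul, ENNReal.toReal_ofReal prm.q_pos.le] at this
    have ih' : P.real A ≤ Real.exp (-(prm.q * n)) :=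
      ENNReal.toReal_le_of_le_ofReal (Real.exp_nonneg _) ih
    rw [← ofReal_measureReal]
    refine ENNReal.ofReal_le_ofReal ?_
    calc P.real (A \ {ω | R.oracle n ω = R.nid x})
        ≤ (-prm.q + 1) * P.real A := by linarith
      _ ≤ Real.exp (-prm.q) * P.real A :=
          mul_le_mul_of_nonneg_right (Real.add_one_le_exp _) measureReal_nonneg
      _ ≤ Real.exp (-prm.q) * Real.exp (-(prm.q * n)) :=
          mul_le_mul_of_nonneg_left ih' (Real.exp_nonneg _)
      _ = Real.exp (-(prm.q * (n + 1 : ℕ))) := by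
          rw [← Real.exp_add]; push_cast; congr 1; ring

/-- The failure probability of the round-robin strategy. -/
theorem measure_not_found_le [Fintype V] [Countable C] {N B M : ℕ} {L D Δ : ℝ}
    (h : R.IsQuasiLive prm
      (roundRobin prm.maxPeers prm.two_le_maxPeers prm.tau N B (L + D) (L + D + Δ)) U P)
    (hD : Fintype.card V * prm.wmax ≤ D) (hL : 0 < L) (hΔ : 0 < Δ)
    (hB : L + D + Δ < B * prm.tau)
    (hM : (N + Fintype.card V ^ 2 * B : ℕ) * prm.tau + prm.wmax ≤ M * prm.tau) :
    P {ω | ¬ R.Found prm.tau (roundRobin prm.maxPeers prm.two_le_maxPeers prm.tau N B (L + D)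
      (L + D + Δ)) U M ω} ≤
      ENNReal.ofReal (U.card * Real.exp (-(prm.q * N)) +
        (Fintype.card V : ℝ) ^ 3 * Real.exp (-(prm.lam * L)) +
        U.card * (Fintype.card V : ℝ) ^ 2 * (prm.mu / Δ)) := by
  classical
  have hτ := prm.tau_pos
  have hμ := prm.mu_pos
  have hD0 : 0 ≤ D := le_trans (mul_nonneg (Nat.cast_nonneg _) prm.wmax_pos.le) hD
  let i₀ : Fin prm.slots := ⟨0, prm.slots_pos⟩
  let st (p : V × V) : ℝ := blockStart N B p * prm.tau
  have hst (p : V × V) : 0 ≤ st p := mul_nonneg (Nat.cast_nonneg _) hτ.le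
  let E₀ : Set Ω := {ω | ¬ R.PathRules prm.tau (roundRobin prm.maxPeers prm.two_le_maxPeers
    prm.tau N B (L + D) (L + D + Δ)) U ω}
  let E₁ : Set Ω := ⋃ x ∈ U, {ω | ∀ i < N, R.oracle i ω ≠ R.nid x}
  -- One fixed slot per node is enough. The union runs over all blocks and all nodes, whence the
  -- cube of `Fintype.card V`.
  let E₂ : Set Ω := ⋃ z ∈ (Finset.univ : Finset ((V × V) × V)),
    {ω | R.Blocked z.2 i₀ (st z.1) (st z.1 + L) ω}
  let E₃ : Set Ω := ⋃ z ∈ U ×ˢ (Finset.univ : Finset (V × V)),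
    {ω | (R.count z.1 (st z.2 + (L + D) + Δ) ω : ℝ) - R.count z.1 (st z.2 + (L + D)) ω <
      prm.gam * Δ}
  have h₀ : P E₀ = 0 := ae_iff.1 h.rules
  have h₁ : P E₁ ≤ ENNReal.ofReal (U.card * Real.exp (-(prm.q * N))) := by
    refine (measure_biUnion_finset_le _ _).trans ?_
    refine (Finset.sum_le_card_nsmul _ _ _ fun x hx => h.measure_not_named_le hx N).trans ?_
    rw [nsmul_eq_mul, ENNReal.ofReal_mul (Nat.cast_nonneg _), ENNReal.ofReal_natCast]
  have h₂ : P E₂ ≤ ENNReal.ofReal ((Fintype.card V : ℝ) ^ 3 * Real.exp (-(prm.lam * L))) := by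
    refine (measure_biUnion_finset_le _ _).trans ?_
    refine (Finset.sum_le_card_nsmul _ _ _ fun z _ =>
      h.measure_blocked_le z.2 i₀ (hst z.1) hL.le).trans ?_
    rw [nsmul_eq_mul, ENNReal.ofReal_mul (by positivity), Finset.card_univ, Fintype.card_prod,
      Fintype.card_prod, ← ENNReal.ofReal_natCast]
    gcongr
    push_cast
    exact le_of_eq (by ring)
  have h₃ : P E₃ ≤ ENNReal.ofReal (U.card * (Fintype.card V : ℝ) ^ 2 * (prm.mu / Δ)) := by
    refine (measure_biUnion_finset_le _ _).trans ?_
    -- The activity condition requires a strictly positive starting time, which `L > 0` provides.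
    refine (Finset.sum_le_card_nsmul _ _ _ fun z hz =>
      (h.active z.1 (Finset.mem_product.1 hz).1 (st z.2 + (L + D)) Δ
        (by have := hst z.2; linarith) hΔ).le).trans ?_
    rw [nsmul_eq_mul, ENNReal.ofReal_mul (by positivity), Finset.card_product, Finset.card_univ,
      Fintype.card_prod, ← ENNReal.ofReal_natCast]
    gcongr
    push_cast
    exact le_of_eq (by ring)
  have hsub : {ω | ¬ R.Found prm.tau (roundRobin prm.maxPeers prm.two_le_maxPeers prm.tau N B
      (L + D) (L + D + Δ)) U M ω} ⊆ E₀ ∪ (E₁ ∪ E₂ ∪ E₃) := by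
    intro ω hω
    by_contra hno
    simp only [Set.mem_union, not_or] at hno
    obtain ⟨hn₀, ⟨hn₁, hn₂⟩, hn₃⟩ := hno
    simp only [E₁, E₂, E₃, Set.mem_iUnion, Set.mem_ofPred_eq, not_exists] at hn₁ hn₂ hn₃
    refine hω ((not_not.1 hn₀).found_roundRobin hτ h.dist_pos h.dist_le prm.wmax_pos.le hD hL.le
      hΔ.le hB hM i₀ (fun x hx => ?_) (fun p v => hn₂ (p, v) (Finset.mem_univ _))
      fun x hx p => ?_)
    · simpa using hn₁ x hx
    · have h1 := hn₃ (x, p) (Finset.mem_product.2 ⟨hx, Finset.mem_univ _⟩)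
      have h2 : 0 < prm.gam * Δ := mul_pos prm.gam_pos hΔ
      have h3 : (R.count x (st p + (L + D)) ω : ℝ) < R.count x (st p + (L + D) + Δ) ω := by
        dsimp only at h1
        linarith
      exact_mod_cast h3
  calc _ ≤ P (E₀ ∪ (E₁ ∪ E₂ ∪ E₃)) := measure_mono hsub
    _ ≤ P E₀ + (P E₁ + P E₂ + P E₃) :=
        (measure_union_le _ _).trans (add_le_add le_rfl ((measure_union_le _ _).trans
          (add_le_add (measure_union_le _ _) le_rfl)))
    _ ≤ _ := by
        rw [h₀, zero_add, ENNReal.ofReal_add (by positivity) (by positivity),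
          ENNReal.ofReal_add (by positivity) (by positivity)]
        exact add_le_add (add_le_add h₁ h₂) h₃

end Run.IsQuasiLive

end PeerNet

/-! ### Choice of the parameters -/

namespace PeerNet

/-- This crude tail bound suffices: the activity bound `mu / Δ` already forces blocks of order
`U.card / ε`, so logarithmic choices of `N` and `L` would not improve the order of the total time.
-/
theorem exp_neg_le_of_le {x y : ℝ} (hx : 0 < x) (hxy : x ≤ y) : Real.exp (-y) ≤ 1 / x := by
  rw [Real.exp_neg, ← one_div]
  exact one_div_le_one_div_of_le hx (by linarith [Real.add_one_le_exp y])

end PeerNet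

theorem mainTheorem2 (prm : PeerNet.Params) (ε₀ : ℝ) (hε₀ : 0 < ε₀) (hε₀' : ε₀ < 1) :
    ∃ K : ℝ, 0 < K ∧
      ∀ (V W : Type*) [Fintype V], Fintype.card V ≤ prm.maxNodes →
      ∀ (U : Finset W) (ε : ℝ), 0 < ε → ε ≤ ε₀ →
      ∃ (σ : PeerNet.Strategy V W prm.maxPeers) (N : ℕ),
        N * prm.tau ≤ K * ((U.card : ℝ) ^ 2 * ε⁻¹ * Real.log ε⁻¹ ^ 2) ∧
        ∀ (C Ω : Type*) [Countable C] [MeasurableSpace Ω] (P : Measure Ω)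
          [IsProbabilityMeasure P] (R : PeerNet.Run V W C Ω prm.slots),
          R.IsQuasiLive prm σ U P →
          P {ω | ¬ R.Found prm.tau σ U N ω} ≤ ENNReal.ofReal ε := by
  have hq := prm.q_pos
  have hτ := prm.tau_pos
  have hlam := prm.lam_pos
  have hμ := prm.mu_pos
  have hw := prm.wmax_pos
  let m : ℝ := prm.maxNodes + 1
  have hm : 0 < m := by positivity
  let ℓ : ℝ := Real.log ε₀⁻¹
  have hℓ : 0 < ℓ := Real.log_pos ((one_lt_inv₀ hε₀).2 hε₀')
  let K' : ℝ := 3 / prm.q * prm.tau + prm.tau +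
    m ^ 2 * (3 * m ^ 3 / prm.lam + m * prm.wmax + 3 * m ^ 2 * prm.mu + prm.tau) +
    (prm.wmax + prm.tau)
  have hK' : 0 < K' := by positivity
  refine ⟨K' / ℓ ^ 2, by positivity, fun V W _ hV U ε hε hεε₀ => ?_⟩
  have hcm : (Fintype.card V : ℝ) ≤ m := by
    have : (Fintype.card V : ℝ) ≤ prm.maxNodes := by exact_mod_cast hV
    exact this.trans (le_add_of_nonneg_right zero_le_one)
  -- With no targets the time bound is 0, so the agent must stop at step 0, where success is
  -- vacuous.
  rcases U.eq_empty_or_nonempty with rfl | hU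
  · refine ⟨⟨fun _ => ∅, fun _ _ => none, by simp, by simp⟩, 0, by simp, ?_⟩
    intro C Ω _ _ P _ R _
    simp [PeerNet.Run.Found]
  have hU1 : (1 : ℝ) ≤ U.card := by exact_mod_cast hU.card_pos
  have hU0 : (0 : ℝ) < U.card := by linarith
  -- The common scale of all durations. Since `1 ≤ z`, additive constants and rounding errors are
  -- absorbed into multiples of `z`.
  let z : ℝ := U.card / ε
  have hz : 1 ≤ z := (one_le_div hε).2 (by linarith)
  have hz0 : 0 < z := by linarith
  have hεz : 1 / z ≤ ε := by
    rw [one_div_div]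
    exact div_le_self hε.le hU1
  -- The factors 3 in `N`, `L` and `Δ` give each of the three kinds of failure a share `ε / 3`.
  let N : ℕ := ⌈3 / prm.q * z⌉₊
  let L : ℝ := 3 * m ^ 3 / prm.lam * z
  let D : ℝ := m * prm.wmax
  let Δ : ℝ := 3 * m ^ 2 * prm.mu * z
  have hL : 0 < L := by positivity
  have hD : 0 < D := by positivity
  have hΔ : 0 < Δ := by positivity
  -- Floor plus one makes the block strictly longer than `L + D + Δ`, so that the end of the window
  -- still lies inside the half-open block.
  let B : ℕ := ⌊(L + D + Δ) / prm.tau⌋₊ + 1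
  let M : ℕ := N + Fintype.card V ^ 2 * B + ⌈prm.wmax / prm.tau⌉₊
  have hB : L + D + Δ < B * prm.tau := by
    have := Nat.lt_floor_add_one ((L + D + Δ) / prm.tau)
    rw [div_lt_iff₀ hτ] at this
    exact_mod_cast this
  have hB' : B * prm.tau ≤ L + D + Δ + prm.tau := by
    have := Nat.floor_le (a := (L + D + Δ) / prm.tau) (by positivity)
    rw [le_div_iff₀ hτ] at this
    simp only [B]
    push_cast
    linarith
  have hN : 3 / prm.q * z ≤ N := Nat.le_ceil _
  have hN' : (N : ℝ) ≤ 3 / prm.q * z + 1 := (Nat.ceil_lt_add_one (by positivity)).le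
  have hS : prm.wmax ≤ ⌈prm.wmax / prm.tau⌉₊ * prm.tau := (div_le_iff₀ hτ).1 (Nat.le_ceil _)
  have hS' : ⌈prm.wmax / prm.tau⌉₊ * prm.tau ≤ prm.wmax + prm.tau := by
    have := (Nat.ceil_lt_add_one (a := prm.wmax / prm.tau) (by positivity)).le
    calc _ ≤ (prm.wmax / prm.tau + 1) * prm.tau := by gcongr
      _ = _ := by field_simp
  have hM : (N + Fintype.card V ^ 2 * B : ℕ) * prm.tau + prm.wmax ≤ M * prm.tau := by
    simp only [M]
    push_cast
    linarith
  refine ⟨PeerNet.roundRobin prm.maxPeers prm.two_le_maxPeers prm.tau N B (L + D) (L + D + Δ), M,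
    ?_, ?_⟩
  · have h1 : M * prm.tau ≤ K' * z := by
      calc (M : ℝ) * prm.tau
          = N * prm.tau + (Fintype.card V : ℝ) ^ 2 * (B * prm.tau) +
            ⌈prm.wmax / prm.tau⌉₊ * prm.tau := by
            simp only [M]
            push_cast
            ring
        _ ≤ (3 / prm.q * z + 1) * prm.tau + m ^ 2 * (L + D + Δ + prm.tau) +
            (prm.wmax + prm.tau) := by gcongr
        _ ≤ (3 / prm.q * z + z) * prm.tau + m ^ 2 * (L + D * z + Δ + prm.tau * z) +
            (prm.wmax + prm.tau) * z := by
            gcongr <;> exact le_mul_of_one_le_right (by positivity) hz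
        _ = K' * z := by
            simp only [K', L, D, Δ]
            ring
    have h2 : ℓ ≤ Real.log ε⁻¹ :=
      Real.log_le_log (inv_pos.2 hε₀) (inv_anti₀ hε hεε₀)
    calc (M : ℝ) * prm.tau ≤ K' * z := h1
      -- The bound is linear in `U.card / ε`; dividing the constant by `ℓ ^ 2` allows the
      -- logarithmic factor to be inserted.
      _ = K' / ℓ ^ 2 * (U.card * ε⁻¹ * ℓ ^ 2) := by
          simp only [z]
          field_simp
      _ ≤ K' / ℓ ^ 2 * ((U.card : ℝ) ^ 2 * ε⁻¹ * Real.log ε⁻¹ ^ 2) := by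
          gcongr
          exact le_self_pow₀ hU1 two_ne_zero
  · intro C Ω _ _ P _ R hR
    have hDV : Fintype.card V * prm.wmax ≤ D := mul_le_mul_of_nonneg_right hcm hw.le
    refine (hR.measure_not_found_le hDV hL hΔ hB hM).trans (ENNReal.ofReal_le_ofReal ?_)
    have e1 : U.card * Real.exp (-(prm.q * N)) ≤ ε / 3 := by
      have h3 : 3 * z ≤ prm.q * N := by
        calc 3 * z = prm.q * (3 / prm.q * z) := by field_simp
          _ ≤ _ := by gcongr
      calc U.card * Real.exp (-(prm.q * N)) ≤ U.card * (1 / (3 * z)) := by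
            gcongr
            exact PeerNet.exp_neg_le_of_le (by positivity) h3
        _ = ε / 3 := by
            simp only [z]
            field_simp
    have e2 : (Fintype.card V : ℝ) ^ 3 * Real.exp (-(prm.lam * L)) ≤ ε / 3 := by
      calc (Fintype.card V : ℝ) ^ 3 * Real.exp (-(prm.lam * L))
          ≤ m ^ 3 * (1 / (prm.lam * L)) := by
            gcongr
            exact PeerNet.exp_neg_le_of_le (by positivity) le_rfl
        _ = 1 / z / 3 := by
            simp only [L]
            field_simp
        _ ≤ ε / 3 := by gcongr
    have e3 : U.card * (Fintype.card V : ℝ) ^ 2 * (prm.mu / Δ) ≤ ε / 3 := by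
      calc U.card * (Fintype.card V : ℝ) ^ 2 * (prm.mu / Δ)
          ≤ U.card * m ^ 2 * (prm.mu / Δ) := by gcongr
        _ = ε / 3 := by
            simp only [Δ, z]
            field_simp
    linarith
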